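/- For a finite simple graph $G$ let $\Delta(G)$ be its maximum degree. A set $D\subseteq V(G)$ is dominating (respectively, $k$-dominating) if every vertex outside $D$ has at least one neighbour (respectively, at least $k$ neighbours) in $D$; the domination number $\gamma(G)$ and the $k$-domination number $\gamma_k(G)$ are the minimum cardinalities of a dominating set and of a $k$-dominating set of $G$. **Proposition.** Let $k\ge 3$ be a fixed integer. There is a polynomial-time algorithm which, given (the adjacency matrix of) a bipartite graph $G$, connected or not, with $\Delta(G)\ge k$, decides whether $$\gamma_k(G)=\gamma(G)+k-2 .$$ More precisely, there are a single program of a deterministic random access machine (with unit-cost addition, truncated subtraction, indirect addressing, and no multiplication) and a polynomial $p$, both depending only on $k$, such that for every bipartite graph $G$ with $\Delta(G)\ge k$ the program, run on the binary string that encodes $G$, halts after at most $p(N)$ steps, where $N$ is the length of the string, with answer $1$ if the equality holds and with answer $0$ if it does not. Here a graph on $\{0,\dots,n-1\}$ is encoded by $n$ in unary, a separator, and the $n^2$ entries of its adjacency matrix, row by row. -/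

import Mathlib

/-! ### Domination in graphs -/

namespace SimpleGraph

variable {V : Type*} (G : SimpleGraph V)

/-- `D` is dominating: every vertex outside `D` has at least one neighbour in `D`. -/
def IsDominatingSet (D : Finset V) : Prop :=
  ∀ v, v ∉ D → ∃ u ∈ D, G.Adj v u

/-- `D` is `k`-dominating: every vertex outside `D` has at least `k` neighbours in `D`. -/
def IsKDominatingSet (k : ℕ) (D : Finset V) : Prop :=
  ∀ v, v ∉ D → k ≤ {u | u ∈ D ∧ G.Adj v u}.ncard

/-- The domination number: the minimum cardinality of a dominating set.
On a finite graph the set of cardinalities is nonempty, since the whole vertex set is dominating. -/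
noncomputable def dominationNumber : ℕ :=
  sInf {m | ∃ D : Finset V, G.IsDominatingSet D ∧ D.card = m}

/-- The `k`-domination number: the minimum cardinality of a `k`-dominating set. -/
noncomputable def kDominationNumber (k : ℕ) : ℕ :=
  sInf {m | ∃ D : Finset V, G.IsKDominatingSet k D ∧ D.card = m}

/-- The binary string presenting a graph with vertex set `Fin n`: the order `n` in unary,
ended by `false`, followed by the `n * n` entries of the adjacency matrix, row by row. -/
def encode {n : ℕ} (G : SimpleGraph (Fin n)) [DecidableRel G.Adj] : List Bool :=
  List.replicate n true ++ false ::
    List.ofFn (fun p : Fin (n * n) => decide (G.Adj p.divNat p.modNat))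

end SimpleGraph

/-! ### Random access machines

The machine has a read-only binary input string and a memory of registers `0, 1, 2, …`, each of
which holds a natural number. Arithmetic is limited to addition and truncated subtraction. For such
an instruction set (no multiplication) unit-cost time is polynomially related to the time of a
multi-tape Turing machine: in `t` steps the registers hold numbers of `O(t)` bits only. -/

namespace Ram

/-- Contents of the memory. -/
abbrev Mem : Type := ℕ → ℕ

/-- Programs. Below `M` is the memory and `w` the input string. -/
inductive Prog : Type
  /-- `M[x] := c` -/
  | const (x c : ℕ)
  /-- `M[x] := M[y] + M[z]` -/
  | add (x y z : ℕ)
  /-- `M[x] := M[y] - M[z]`, truncated at zero -/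
  | sub (x y z : ℕ)
  /-- `M[x] := M[M[y]]` -/
  | load (x y : ℕ)
  /-- `M[M[x]] := M[y]` -/
  | store (x y : ℕ)
  /-- `M[x] := w[M[y]]` -/
  | read (x y : ℕ)
  /-- first `p`, then `q` -/
  | seq (p q : Prog)
  /-- if `M[x] ≠ 0` then `p` else `q` -/
  | cond (x : ℕ) (p q : Prog)
  /-- while `M[x] ≠ 0` do `p` -/
  | loop (x : ℕ) (p : Prog)

/-- The value read at position `i` of the input: the bit `0` or `1`, and `2` beyond the end. -/
def inputAt (w : List Bool) (i : ℕ) : ℕ :=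
  match w[i]? with
  | some b => b.toNat
  | none => 2

/-- `Exec w c m t m'`: on input `w`, the program `c` started with memory `m` halts after exactly
`t` steps with memory `m'`. Every assignment and every test of a register is one step. -/
inductive Exec (w : List Bool) : Prog → Mem → ℕ → Mem → Prop
  | const (x c : ℕ) (m : Mem) : Exec w (.const x c) m 1 (Function.update m x c)
  | add (x y z : ℕ) (m : Mem) : Exec w (.add x y z) m 1 (Function.update m x (m y + m z))
  | sub (x y z : ℕ) (m : Mem) : Exec w (.sub x y z) m 1 (Function.update m x (m y - m z))
  | load (x y : ℕ) (m : Mem) : Exec w (.load x y) m 1 (Function.update m x (m (m y)))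
  | store (x y : ℕ) (m : Mem) : Exec w (.store x y) m 1 (Function.update m (m x) (m y))
  | read (x y : ℕ) (m : Mem) : Exec w (.read x y) m 1 (Function.update m x (inputAt w (m y)))
  | seq {p q : Prog} {m m' m'' : Mem} {s t : ℕ} :
      Exec w p m s m' → Exec w q m' t m'' → Exec w (.seq p q) m (s + t) m''
  | condPos {x : ℕ} {p q : Prog} {m m' : Mem} {t : ℕ} :
      m x ≠ 0 → Exec w p m t m' → Exec w (.cond x p q) m (t + 1) m'
  | condZero {x : ℕ} {p q : Prog} {m m' : Mem} {t : ℕ} :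
      m x = 0 → Exec w q m t m' → Exec w (.cond x p q) m (t + 1) m'
  | loopStop {x : ℕ} {p : Prog} {m : Mem} :
      m x = 0 → Exec w (.loop x p) m 1 m
  | loopStep {x : ℕ} {p : Prog} {m m' m'' : Mem} {s t : ℕ} :
      m x ≠ 0 → Exec w p m s m' → Exec w (.loop x p) m' t m'' →
        Exec w (.loop x p) m (s + t + 1) m''

/-- The machine is deterministic: running time and final memory are determined by the start. -/
theorem Exec.deterministic {w : List Bool} {c : Prog} {m m₁ m₂ : Mem} {t₁ t₂ : ℕ}
    (h₁ : Exec w c m t₁ m₁) (h₂ : Exec w c m t₂ m₂) : t₁ = t₂ ∧ m₁ = m₂ := by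
  induction h₁ generalizing t₂ m₂ with
  | seq _ _ ih ih' =>
    cases h₂ with
    | seq a b =>
      obtain ⟨rfl, rfl⟩ := ih a
      obtain ⟨rfl, rfl⟩ := ih' b
      exact ⟨rfl, rfl⟩
  | condPos h _ ih =>
    cases h₂ with
    | condPos _ a => obtain ⟨rfl, rfl⟩ := ih a; exact ⟨rfl, rfl⟩
    | condZero h' _ => exact absurd h' h
  | condZero h _ ih =>
    cases h₂ with
    | condPos h' _ => exact absurd h h'
    | condZero _ a => obtain ⟨rfl, rfl⟩ := ih a; exact ⟨rfl, rfl⟩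
  | loopStop h =>
    cases h₂ with
    | loopStop _ => exact ⟨rfl, rfl⟩
    | loopStep h' _ _ => exact absurd h h'
  | loopStep h _ _ ih ih' =>
    cases h₂ with
    | loopStop h' => exact absurd h' h
    | loopStep _ a b =>
      obtain ⟨rfl, rfl⟩ := ih a
      obtain ⟨rfl, rfl⟩ := ih' b
      exact ⟨rfl, rfl⟩
  | _ => cases h₂; exact ⟨rfl, rfl⟩

/-- On input `w`, the program `c`, started with all registers zero, halts within `T` steps and
answers in register `0` the question whether `P` holds: `1` if it does and `0` if it does not. -/
def DecidesWithin (c : Prog) (w : List Bool) (T : ℕ) (P : Prop) : Prop :=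
  ∃ (t : ℕ) (m : Mem), Exec w c (fun _ => 0) t m ∧ t ≤ T ∧ (P → m 0 = 1) ∧ (¬P → m 0 = 0)

end Ram

/-! For fixed `k` and bipartite `G` with `Δ ≥ k`, the equality is equivalent to a first-order
sentence about `G`, and such sentences are decided in polynomial time by nested loops over the
vertices. The sentence comes from exchange arguments. Let `D` be a minimum `k`-dominating set; it
misses some `v`. Replacing `k - 1` neighbours of `v` in `D` by `v` gives `γ ≤ γₖ - k + 2`. If this
is an equality, no exchange may gain more than `k - 2`. This forces the complement `A` of `D` to lie
in one colour class, to contain every non-isolated vertex of that class, and to consist exactly of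
the vertices at the end of a walk of length four from `v` (`IsKDominatingSet.color_eq`,
`IsKDominatingSet.notMem_of_adj`, `IsKDominatingSet.fourStep`). So `D` is definable from the single
vertex `v`. Conversely, given such an `A`, it remains to exclude exchanges `S` for `T` with gain `k
- 1`. By `IsExchange.exists_card_lt` it suffices to exclude those with `|T| < k`, a bounded number
of vertices, hence a first-order condition (`IsLocallyOptimal`). -/

/-! ### Evaluating first-order formulas on the random access machine. -/

namespace Ram

/-- On a graph encoding, with the order `n` in register `1`, the constant `1` in register `2` and
the values of `m` variables in the registers from `5` on, the program `c` computes the truth value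
of `P` in register `0` within `T n` steps, and preserves all those registers. -/
def Evaluates {m : ℕ} (c : Prog) (T : Polynomial ℕ)
    (P : ∀ n, SimpleGraph (Fin n) → (Fin m → Fin n) → Prop) : Prop :=
  ∀ (n : ℕ) (G : SimpleGraph (Fin n)) [DecidableRel G.Adj] (v : Fin m → Fin n) (M : Mem),
    M 1 = n → M 2 = 1 → (∀ i : Fin m, M (i + 5) = v i) →
      ∃ (t : ℕ) (M' : Mem), Exec G.encode c M t M' ∧ t ≤ T.eval n ∧
        (P n G v → M' 0 = 1) ∧ (¬P n G v → M' 0 = 0) ∧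
        ∀ j, j = 1 ∨ j = 2 ∨ (5 ≤ j ∧ j < m + 5) → M' j = M j

theorem inputAt_encode_adj {n : ℕ} (G : SimpleGraph (Fin n)) [DecidableRel G.Adj] (x y : Fin n) :
    inputAt G.encode (n + 1 + y + x * n) = (decide (G.Adj x y)).toNat := by
  have hlt : x * n + y < n * n := by
    have := x.2
    have := y.2
    nlinarith
  have h : G.encode[n + 1 + (y : ℕ) + x * n]? = some (decide (G.Adj x y)) := by
    unfold SimpleGraph.encode
    rw [List.getElem?_append_right (by simp; omega)]
    have e : n + 1 + (y : ℕ) + x * n - (List.replicate n true).length = (x * n + y) + 1 := by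
      simp; omega
    rw [e, List.getElem?_cons_succ, List.getElem?_ofFn, dif_pos hlt]
    have hn : 0 < n := x.pos
    have h1 : Fin.divNat (⟨x * n + y, hlt⟩ : Fin (n * n)) = x := by
      ext
      simp [Fin.divNat, Nat.add_div_of_dvd_right, hn, Nat.div_eq_of_lt y.2, Nat.mul_comm]
    have h2 : Fin.modNat (⟨x * n + y, hlt⟩ : Fin (n * n)) = y := by
      ext
      simp [Fin.modNat, Nat.mod_eq_of_lt y.2]
    rw [h1, h2]
  simp [inputAt, h]

/-- Adds register `1` to register `3` as many times as register `4` says. -/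
def mulAdd : Prog := .loop 4 (.seq (.add 3 3 1) (.sub 4 4 2))

theorem exec_mulAdd (w : List Bool) (x : ℕ) (M : Mem) (h2 : M 2 = 1) (h4 : M 4 = x) :
    ∃ M', Exec w mulAdd M (3 * x + 1) M' ∧ M' 3 = M 3 + x * M 1 ∧
      ∀ j, j ≠ 3 → j ≠ 4 → M' j = M j := by
  induction x generalizing M with
  | zero => exact ⟨M, .loopStop h4, by simp, fun _ _ _ => rfl⟩
  | succ x ih =>
    obtain ⟨M', hM', h3, hj⟩ := ih
      (Function.update (Function.update M 3 (M 3 + M 1)) 4 (M 4 - M 2))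
      (by simp [h2]) (by simp [h2, h4])
    refine ⟨M', ?_, ?_, ?_⟩
    · have := Exec.loopStep (x := 4) (by omega) (.seq (.add 3 3 1 M) (.sub 4 4 2 _)) hM'
      have e : 3 * (x + 1) + 1 = 1 + 1 + (3 * x + 1) + 1 := by ring
      rwa [e]
    · rw [h3]
      simp
      ring
    · intro j h3 h4
      rw [hj j h3 h4]
      simp [h3, h4]

theorem evaluates_adj {m : ℕ} (x y : Fin m) :
    ∃ c T, Evaluates c T fun _ G v => G.Adj (v x) (v y) := by
  -- Register 3 accumulates the address `n + 1 + y + x * n`, the product by repeated addition. The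
  -- zero in register 0 turns the next addition into a copy of `x`.
  refine ⟨.seq (.add 3 1 2) (.seq (.add 3 3 (y + 5)) (.seq (.const 0 0)
    (.seq (.add 4 (x + 5) 0) (.seq mulAdd (.read 0 3))))), 3 * .X + 6, ?_⟩
  intro n G _ v M h1 h2 hv
  obtain ⟨M', hM', h3, hj⟩ := exec_mulAdd G.encode (v x)
    (Function.update (Function.update (Function.update (Function.update M 3 (M 1 + M 2)) 3
      (M 1 + M 2 + M (y + 5))) 0 0) 4 (M (x + 5))) (by simp [h2]) (by simp [hv])
  have key : inputAt G.encode (M' 3) = (decide (G.Adj (v x) (v y))).toNat := by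
    rw [← inputAt_encode_adj, h3]
    simp [h1, h2, hv]
  refine ⟨1 + (1 + (1 + (1 + ((3 * v x + 1) + 1)))),
    Function.update M' 0 (inputAt G.encode (M' 3)),
    .seq (.add 3 1 2 _) (.seq (.add 3 3 (y + 5) _) (.seq (.const 0 0 _)
      (.seq (.add 4 (x + 5) 0 _) (.seq (by simpa using hM') (.read 0 3 _))))), ?_, ?_, ?_, ?_⟩
  · have := (v x).2
    simp
    omega
  · intro h
    simp [key, h]
  · intro h
    simp [key, h]
  · intro j h
    rw [Function.update_of_ne (by omega), hj j (by omega) (by omega),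
      Function.update_of_ne (by omega), Function.update_of_ne (by omega),
      Function.update_of_ne (by omega), Function.update_of_ne (by omega)]

theorem evaluates_eq {m : ℕ} (x y : Fin m) :
    ∃ c T, Evaluates c T fun _ _ v => v x = v y := by
  -- The two truncated differences add up to zero exactly when the values agree.
  refine ⟨.seq (.sub 0 (x + 5) (y + 5)) (.seq (.sub 3 (y + 5) (x + 5)) (.seq (.add 0 0 3)
    (.cond 0 (.const 0 0) (.const 0 1)))), 5, ?_⟩
  intro n G _ v M h1 h2 hv
  by_cases h : v x = v y
  · refine ⟨_, _, .seq (.sub _ _ _ _) (.seq (.sub _ _ _ _) (.seq (.add _ _ _ _)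
      (.condZero ?_ (.const _ _ _)))), ?_, ?_, ?_, ?_⟩
    · simp [hv, h]
    · simp
    · simp
    · simp [h]
    · intro j h
      rw [Function.update_of_ne (by omega), Function.update_of_ne (by omega),
        Function.update_of_ne (by omega), Function.update_of_ne (by omega)]
  · refine ⟨_, _, .seq (.sub _ _ _ _) (.seq (.sub _ _ _ _) (.seq (.add _ _ _ _)
      (.condPos ?_ (.const _ _ _)))), ?_, ?_, ?_, ?_⟩
    · rw [Fin.ext_iff] at h
      simp [hv]
      omega
    · simp
    · simp [h]
    · simp
    · intro j h
      rw [Function.update_of_ne (by omega), Function.update_of_ne (by omega),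
        Function.update_of_ne (by omega), Function.update_of_ne (by omega)]

theorem evaluates_false {m : ℕ} : ∃ c T, Evaluates (m := m) c T fun _ _ _ => False := by
  refine ⟨.const 0 0, 1, ?_⟩
  intro n G _ v M h1 h2 hv
  refine ⟨_, _, .const _ _ _, by simp, by simp, by simp, ?_⟩
  intro j h
  rw [Function.update_of_ne (by omega)]

theorem evaluates_imp {m : ℕ} {P Q : ∀ n, SimpleGraph (Fin n) → (Fin m → Fin n) → Prop}
    (hP : ∃ c T, Evaluates c T P) (hQ : ∃ c T, Evaluates c T Q) :
    ∃ c T, Evaluates c T fun n G v => P n G v → Q n G v := by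
  obtain ⟨c, T, hP⟩ := hP
  obtain ⟨d, U, hQ⟩ := hQ
  refine ⟨.seq c (.cond 0 d (.const 0 1)), T + U + 2, ?_⟩
  intro n G _ v M h1 h2 hv
  obtain ⟨t, M', he, ht, hp, hn, hj⟩ := hP n G v M h1 h2 hv
  by_cases h : P n G v
  · obtain ⟨s, M'', he', hs, hp', hn', hj'⟩ := hQ n G v M' (by rw [hj _ (by simp), h1])
      (by rw [hj _ (by simp), h2]) (fun i => by rw [hj _ (by omega), hv])
    refine ⟨_, _, .seq he (.condPos (by simp [hp h]) he'), ?_, ?_, ?_, ?_⟩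
    · simp
      omega
    · exact fun k => hp' (k h)
    · exact fun k => hn' fun q => k fun _ => q
    · intro j h
      rw [hj' j h, hj j h]
  · refine ⟨_, _, .seq he (.condZero (hn h) (.const _ _ _)), ?_, ?_, ?_, ?_⟩
    · simp
      omega
    · simp
    · exact fun k => absurd (fun p => absurd p h) k
    · intro j h
      rw [Function.update_of_ne (by omega), hj j h]

/-- Runs `c` for all values below that of register `x`, as long as `c` answers `1`. -/
def forallBelow (x : ℕ) (c : Prog) : Prog :=
  .loop x (.seq (.sub x x 2) (.seq c (.cond 0 (.const 3 0) (.const x 0))))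

/-- The loop counter, once decremented, is itself the register of the quantified variable. A failure
zeroes the counter, so the loop ends with the answer 0 in place; after a success the write to
scratch register 3 does nothing of importance. -/
theorem exec_forallBelow {m : ℕ} {P : ∀ n, SimpleGraph (Fin n) → (Fin (m + 1) → Fin n) → Prop}
    {c : Prog} {T : Polynomial ℕ} (hP : Evaluates c T P) {n : ℕ} (G : SimpleGraph (Fin n))
    [DecidableRel G.Adj] (v : Fin m → Fin n) (i : ℕ) (M : Mem) (hi : i ≤ n) (h0 : M 0 = 1)
    (h1 : M 1 = n) (h2 : M 2 = 1) (hv : ∀ j : Fin m, M (j + 5) = v j) (hx : M (m + 5) = i) :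
    ∃ (t : ℕ) (M' : Mem), Exec G.encode (forallBelow (m + 5) c) M t M' ∧
      t ≤ i * (T.eval n + 5) + 1 ∧
      ((∀ a : Fin n, a < i → P n G (Fin.snoc v a)) → M' 0 = 1) ∧
      (¬(∀ a : Fin n, a < i → P n G (Fin.snoc v a)) → M' 0 = 0) ∧
      ∀ j, j = 1 ∨ j = 2 ∨ (5 ≤ j ∧ j < m + 5) → M' j = M j := by
  induction i generalizing M with
  | zero =>
    refine ⟨_, _, .loopStop hx, by simp, fun _ => h0, fun h => absurd ?_ h, fun _ _ => rfl⟩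
    intro a h
    omega
  | succ i ih =>
    obtain ⟨t, M', he, ht, hp, hn, hj⟩ := hP n G (Fin.snoc v ⟨i, hi⟩)
      (Function.update M (m + 5) (M (m + 5) - M 2)) (by simp [h1]) (by simp [h2]) (by
        intro j
        refine Fin.lastCases ?_ (fun j => ?_) j
        · simp [hx, h2]
        · have := j.2
          simp [hv, this.ne])
    by_cases h : P n G (Fin.snoc v ⟨i, hi⟩)
    · obtain ⟨s, M'', he', hs, hp', hn', hj'⟩ := ih (Function.update M' 3 0) (by omega)
        (by simp [hp h]) (by simp [hj 1, h1]) (by simp [hj 2, h2])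
        (fun j => by
          rw [Function.update_of_ne (by omega), hj _ (by omega),
            Function.update_of_ne (by omega), hv])
        (by
          rw [Function.update_of_ne (by omega), hj _ (by omega)]
          simp [hx, h2])
      have hiff : (∀ a : Fin n, (a : ℕ) < i + 1 → P n G (Fin.snoc v a)) ↔
          ∀ a : Fin n, (a : ℕ) < i → P n G (Fin.snoc v a) := by
        refine ⟨fun k a ha => k a (by omega), fun k a ha => ?_⟩
        rcases Nat.lt_succ_iff_lt_or_eq.1 ha with h' | h'
        · exact k a h'
        · have : a = ⟨i, hi⟩ := Fin.ext h'
          rwa [this]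
      refine ⟨_, _, .loopStep (by omega) (.seq (.sub _ _ _ _) (.seq he
        (.condPos (by simp [hp h]) (.const _ _ _)))) he', ?_, ?_, ?_, ?_⟩
      · rw [Nat.succ_mul]
        omega
      · rwa [hiff]
      · rwa [hiff]
      · intro j h
        rw [hj' j h, Function.update_of_ne (by omega), hj j (by omega),
          Function.update_of_ne (by omega)]
    · refine ⟨_, _, .loopStep (by omega) (.seq (.sub _ _ _ _) (.seq he
        (.condZero (by simp [hn h]) (.const _ _ _)))) (.loopStop (by simp)), ?_, ?_, ?_, ?_⟩
      · rw [Nat.succ_mul]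
        have : 0 ≤ i * (T.eval n + 5) := Nat.zero_le _
        omega
      · exact fun k => absurd (k ⟨i, hi⟩ (Nat.lt_succ_self i)) h
      · simp [hn h]
      · intro j h
        rw [Function.update_of_ne (by omega), hj j (by omega), Function.update_of_ne (by omega)]

theorem evaluates_all {m : ℕ} {P : ∀ n, SimpleGraph (Fin n) → (Fin (m + 1) → Fin n) → Prop}
    (hP : ∃ c T, Evaluates c T P) :
    ∃ c T, Evaluates c T fun n G (v : Fin m → Fin n) => ∀ a, P n G (Fin.snoc v a) := by
  obtain ⟨c, T, hP⟩ := hP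
  -- The counter starts as a copy of `n`. The answer is preset to 1, its value if there are no
  -- vertices to test.
  refine ⟨.seq (.const 0 0) (.seq (.add (m + 5) 1 0) (.seq (.const 0 1) (forallBelow (m + 5) c))),
    .X * (T + 5) + 4, ?_⟩
  intro n G _ v M h1 h2 hv
  obtain ⟨t, M', he, ht, hp, hn, hj⟩ := exec_forallBelow hP G v n
    (Function.update (Function.update (Function.update M 0 0) (m + 5) (M 1)) 0 1) le_rfl
    (by simp) (by simp [h1]) (by simp [h2])
    (fun j => by
      rw [Function.update_of_ne (by omega), Function.update_of_ne (by omega),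
        Function.update_of_ne (by omega), hv])
    (by simp [h1])
  refine ⟨1 + (1 + (1 + t)), M', .seq (.const _ _ _) (.seq (.add _ _ _ _)
    (.seq (.const _ _ _) (by simpa using he))), ?_, ?_, ?_, ?_⟩
  · simp
    omega
  · exact fun h => hp fun a _ => h a
  · exact fun h => hn fun k => h fun a => k a a.2
  · intro j h
    rw [hj j h, Function.update_of_ne (by omega), Function.update_of_ne (by omega),
      Function.update_of_ne (by omega)]

-- The language has no function symbols, so terms are variables. Each quantifier adds one nested
-- loop, which multiplies the time by about `n`.
open FirstOrder Language in
theorem evaluates_boundedFormula {m : ℕ} (φ : Language.graph.BoundedFormula Empty m) :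
    ∃ c T, Evaluates c T fun n G (v : Fin m → Fin n) =>
      @BoundedFormula.Realize _ (Fin n) G.structure _ _ φ Empty.elim v := by
  have term : ∀ {m : ℕ} (t : Language.graph.Term (Empty ⊕ Fin m)), ∃ i, t = .var (.inr i) := by
    rintro m (i | f)
    · rcases i with i | i
      · exact i.elim
      · exact ⟨i, rfl⟩
    · exact f.elim
  induction φ with
  | falsum => exact evaluates_false
  | equal s t =>
    obtain ⟨i, rfl⟩ := term s
    obtain ⟨j, rfl⟩ := term t
    exact evaluates_eq i j
  | rel R ts =>
    cases R
    obtain ⟨i, hi⟩ := term (ts 0)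
    obtain ⟨j, hj⟩ := term (ts 1)
    convert evaluates_adj i j using 8 with c T n G v
    change G.Adj (@Term.realize _ _ G.structure _ _ (ts 0))
      (@Term.realize _ _ G.structure _ _ (ts 1)) ↔ _
    rw [hi, hj]
    rfl
  | imp _ _ ih ih' => exact evaluates_imp ih ih'
  | all _ ih => exact evaluates_all ih

/-- Writes the number of leading ones of the input into register `1`. -/
def readOrder : Prog :=
  .seq (.const 2 1) (.seq (.read 0 1) (.loop 0 (.seq (.add 1 1 2) (.read 0 1))))

theorem exec_readOrder_loop (w : List Bool) (n i : ℕ) (M : Mem)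
    (hw : ∀ j < n, inputAt w j = 1) (hn : inputAt w n = 0) (h1 : M 1 + i = n)
    (h2 : M 2 = 1) (h0 : M 0 = inputAt w (M 1)) :
    ∃ M', Exec w (.loop 0 (.seq (.add 1 1 2) (.read 0 1))) M (3 * i + 1) M' ∧
      M' 1 = n ∧ M' 2 = 1 := by
  induction i generalizing M with
  | zero =>
    have h1 : M 1 = n := h1
    exact ⟨M, .loopStop (by rw [h0, h1, hn]), h1, h2⟩
  | succ i ih =>
    obtain ⟨M', hM', h⟩ := ih (Function.update (Function.update M 1 (M 1 + M 2)) 0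
      (inputAt w (M 1 + M 2))) (by simp [h2]; omega) (by simp [h2]) (by simp)
    refine ⟨M', ?_, h⟩
    have := Exec.loopStep (x := 0) (by rw [h0, hw _ (by omega)]; simp)
      (.seq (.add 1 1 2 M) (.read 0 1 _)) (by simpa using hM')
    convert this using 1
    ring

theorem exec_readOrder {n : ℕ} (G : SimpleGraph (Fin n)) [DecidableRel G.Adj] :
    ∃ M', Exec G.encode readOrder (fun _ => 0) (3 * n + 3) M' ∧ M' 1 = n ∧ M' 2 = 1 := by
  obtain ⟨M', hM', h⟩ := exec_readOrder_loop G.encode n n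
    (Function.update (Function.update (fun _ => 0) 2 1) 0 (inputAt G.encode 0))
    (fun j hj => by
      have : G.encode[j]? = some true := by
        unfold SimpleGraph.encode
        rw [List.getElem?_append_left (by simpa using hj)]
        simp [hj]
      simp [inputAt, this])
    (by
      have : G.encode[n]? = some false := by
        unfold SimpleGraph.encode
        rw [List.getElem?_append_right (by simp)]
        simp
      simp [inputAt, this]) (by simp) (by simp) (by simp)
  refine ⟨M', ?_, h⟩
  have e : 3 * n + 3 = 1 + (1 + (3 * n + 1)) := by ring
  rw [e]
  exact .seq (.const 2 1 _) (.seq (.read 0 1 _) hM')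

theorem _root_.Polynomial.eval_mono_nat (p : Polynomial ℕ) : Monotone fun n : ℕ => p.eval n := by
  intro a b h
  simp only [Polynomial.eval_eq_sum, Polynomial.sum]
  gcongr

open FirstOrder Language in
/-- First-order properties of graphs are decidable in polynomial time. -/
theorem decidesWithin_sentence (φ : Language.graph.Sentence) :
    ∃ (c : Prog) (p : Polynomial ℕ), ∀ (n : ℕ) (G : SimpleGraph (Fin n)) [DecidableRel G.Adj],
      DecidesWithin c G.encode (p.eval G.encode.length)
        (@Sentence.Realize _ (Fin n) G.structure φ) := by
  obtain ⟨c, T, hc⟩ := evaluates_boundedFormula φ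
  refine ⟨.seq readOrder c, 3 * .X + 3 + T, ?_⟩
  intro n G _
  obtain ⟨M, hM, h1, h2⟩ := exec_readOrder G
  obtain ⟨t, M', he, ht, hp, hn, -⟩ := hc n G default M h1 h2 (fun i => i.elim0)
  have e : @Sentence.Realize _ (Fin n) G.structure φ ↔
      @BoundedFormula.Realize _ (Fin n) G.structure _ _ φ Empty.elim default := by
    let := G.structure
    rw [Sentence.Realize, Formula.Realize, Subsingleton.elim default Empty.elim]
  refine ⟨_, _, .seq hM he, ?_, fun h => hp (e.1 h), fun h => hn fun k => h (e.2 k)⟩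
  have hle : n ≤ G.encode.length := by simp [SimpleGraph.encode]
  have := T.eval_mono_nat hle
  simp at this ⊢
  omega

end Ram

/-! ### Exchange arguments for dominating sets. -/

namespace SimpleGraph

section Exchange

variable {V : Type*} (G : SimpleGraph V)

theorem dominationNumber_le_card {D : Finset V} (hD : G.IsDominatingSet D) :
    G.dominationNumber ≤ D.card :=
  Nat.sInf_le ⟨D, hD, rfl⟩

theorem kDominationNumber_le_card {k : ℕ} {D : Finset V} (hD : G.IsKDominatingSet k D) :
    G.kDominationNumber k ≤ D.card :=
  Nat.sInf_le ⟨D, hD, rfl⟩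

theorem exists_isDominatingSet_card_eq [Fintype V] :
    ∃ D : Finset V, G.IsDominatingSet D ∧ D.card = G.dominationNumber :=
  Nat.sInf_mem (s := {m | ∃ D : Finset V, G.IsDominatingSet D ∧ D.card = m})
    ⟨_, Finset.univ, fun v hv => absurd (Finset.mem_univ v) hv, rfl⟩

theorem exists_isKDominatingSet_card_eq [Fintype V] (k : ℕ) :
    ∃ D : Finset V, G.IsKDominatingSet k D ∧ D.card = G.kDominationNumber k :=
  Nat.sInf_mem (s := {m | ∃ D : Finset V, G.IsKDominatingSet k D ∧ D.card = m})
    ⟨_, Finset.univ, fun v hv => absurd (Finset.mem_univ v) hv, rfl⟩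

variable {G}

theorem IsKDominatingSet.le_card_filter [DecidableRel G.Adj] {k : ℕ} {D : Finset V}
    (hD : G.IsKDominatingSet k D) {v : V} (hv : v ∉ D) : k ≤ (D.filter (G.Adj v)).card := by
  have := hD v hv
  rwa [← Set.ncard_coe_finset, Finset.coe_filter]

/-- A vertex outside a `k`-dominating set `D` has a neighbour in `D` that avoids a given set with
fewer than `k` elements. -/
theorem IsKDominatingSet.exists_adj_notMem {k : ℕ} {D : Finset V} (hD : G.IsKDominatingSet k D)
    {v : V} (hv : v ∉ D) {S : Finset V} (hS : S.card < k) : ∃ u ∈ D, G.Adj v u ∧ u ∉ S := by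
  classical
  obtain ⟨u, hu, h⟩ := Finset.exists_mem_notMem_of_card_lt_card
    (hS.trans_le (hD.le_card_filter hv))
  exact ⟨u, (Finset.mem_filter.1 hu).1, (Finset.mem_filter.1 hu).2, h⟩

/-- Of the `k` neighbours at most one is `b`. Avoiding `b` matters only in
`IsKDominatingSet.notMem_of_adj`; elsewhere `v` itself serves as a dummy. -/
theorem IsKDominatingSet.exists_subset_card_eq {k : ℕ} {D : Finset V}
    (hD : G.IsKDominatingSet k D) {v : V} (hv : v ∉ D) (b : V) :
    ∃ S ⊆ D, S.card = k - 1 ∧ b ∉ S ∧ ∀ s ∈ S, G.Adj v s := by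
  classical
  have h : k - 1 ≤ ((D.filter (G.Adj v)).erase b).card :=
    (Nat.sub_le_sub_right (hD.le_card_filter hv) 1).trans Finset.pred_card_le_card_erase
  obtain ⟨S, hS, hc⟩ := Finset.exists_subset_card_eq h
  have hS' : ∀ s ∈ S, s ≠ b ∧ s ∈ D ∧ G.Adj v s := fun s hs => by
    simpa [and_assoc] using hS hs
  exact ⟨S, fun s hs => (hS' s hs).2.1, hc, fun h => (hS' b h).1 rfl, fun s hs => (hS' s hs).2.2⟩

/-- Exchanging `S ⊆ D` for `T` gives a dominating set if the vertices of `S` and the vertices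
outside `D` stay dominated. -/
theorem dominationNumber_add_card_le {D S T : Finset V} (hSD : S ⊆ D)
    (hS : ∀ s ∈ S, ∃ t, G.Adj s t ∧ (t ∈ T ∨ t ∈ D ∧ t ∉ S))
    (hD : ∀ v ∉ D, v ∉ T → ∃ u ∈ D, G.Adj v u ∧ u ∉ S) :
    G.dominationNumber + S.card ≤ D.card + T.card := by
  classical
  have h : G.IsDominatingSet (D \ S ∪ T) := by
    intro v hv
    simp only [Finset.mem_union, Finset.mem_sdiff, not_or, not_and, not_not] at hv ⊢
    by_cases h : v ∈ D
    · obtain ⟨t, ht, h⟩ := hS v (hv.1 h)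
      exact ⟨t, h.symm, ht⟩
    · obtain ⟨u, hu, ha, hs⟩ := hD v h hv.2
      exact ⟨u, .inl ⟨hu, hs⟩, ha⟩
  have h1 := (G.dominationNumber_le_card h).trans (Finset.card_union_le _ _)
  have h2 := Finset.card_sdiff_add_card_eq_card hSD
  omega

/-- The bound of Fink and Jacobson. -/
theorem IsKDominatingSet.dominationNumber_add_le {k : ℕ} (hk : 2 ≤ k) {D : Finset V}
    (hD : G.IsKDominatingSet k D) {v : V} (hv : v ∉ D) : G.dominationNumber + k - 2 ≤ D.card := by
  obtain ⟨S, hSD, hc, -, hS⟩ := hD.exists_subset_card_eq hv v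
  have := dominationNumber_add_card_le (T := {v}) hSD
    (fun s hs => ⟨v, (hS s hs).symm, by simp⟩)
    (fun w hw _ => hD.exists_adj_notMem hw (by omega))
  simp at this
  omega

/-- A vertex of degree at least `k` can be left out of the full vertex set. Hence a minimum
`k`-dominating set misses a vertex, the starting point of all exchanges. -/
theorem kDominationNumber_lt_card [Fintype V] [DecidableRel G.Adj] {k : ℕ} (hk : 0 < k)
    (h : k ≤ G.maxDegree) : G.kDominationNumber k < Fintype.card V := by
  classical
  obtain ⟨v, hv⟩ : ∃ v, k ≤ G.degree v := by
    by_contra! hlt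
    have := G.maxDegree_le_of_forall_degree_le (k - 1) fun v => Nat.le_sub_one_of_lt (hlt v)
    omega
  have hD : G.IsKDominatingSet k (Finset.univ.erase v) := by
    intro w hw
    obtain rfl : w = v := by simpa using hw
    refine hv.trans ?_
    rw [← card_neighborFinset_eq_degree, ← Set.ncard_coe_finset]
    refine Set.ncard_le_ncard fun u hu => ?_
    have hu : G.Adj w u := by simpa using hu
    exact ⟨by simp [hu.ne'], hu⟩
  have := G.kDominationNumber_le_card hD
  rw [Finset.card_erase_of_mem (Finset.mem_univ v), Finset.card_univ] at this
  have : 0 < Fintype.card V := Fintype.card_pos_iff.2 ⟨v⟩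
  omega

variable (G) in
/-- If `A` is independent and covers all edges, exchanging `S` for `T` turns the dominating set
`Aᶜ` into a dominating set. -/
def IsExchange (A T S : Finset V) : Prop :=
  T ⊆ A ∧ (∀ s ∈ S, ∃ t ∈ T, G.Adj t s) ∧ ∀ a ∈ A, a ∉ T → ∃ b, G.Adj a b ∧ b ∉ S

theorem IsExchange.mono {A T S S' : Finset V} (h : G.IsExchange A T S) (hS : S' ⊆ S) :
    G.IsExchange A T S' :=
  ⟨h.1, fun s hs => h.2.1 s (hS hs), fun a ha hT =>
    (h.2.2 a ha hT).imp fun _ hb => ⟨hb.1, fun hs => hb.2 (hS hs)⟩⟩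

/-- An exchange that gains at least `k - 1` can be replaced by one of bounded size. -/
theorem IsExchange.exists_card_lt {k : ℕ} (hk : 1 ≤ k) {A T S : Finset V}
    (hA : ∀ a ∈ A, ∃ b, G.Adj a b) (h : G.IsExchange A T S) (hc : T.card + k - 1 ≤ S.card) :
    ∃ T' S', G.IsExchange A T' S' ∧ T'.card < k ∧ S'.card = T'.card + k - 1 := by
  classical
  induction hn : T.card using Nat.strong_induction_on generalizing T S with
  | _ n ih =>
  subst hn
  by_cases hT : T.card < k
  · obtain ⟨S', hS', hc'⟩ := Finset.exists_subset_card_eq hc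
    exact ⟨T, S', h.mono hS', hT, hc'⟩
  -- The private neighbours of `t`: those in `S` with no other neighbour in `T`.
  let priv : V → Finset V := fun t => S.filter fun s => G.Adj t s ∧ ∀ t' ∈ T, G.Adj t' s → t' = t
  by_cases hp : ∀ t ∈ T, 2 ≤ (priv t).card
  · obtain ⟨T', hT', hcT⟩ := Finset.exists_subset_card_eq (s := T) (n := k - 1) (by omega)
    have hS' : IsExchange G A T' (S.filter fun s => ∃ t ∈ T', G.Adj t s) := by
      refine ⟨hT'.trans h.1, fun s hs => (Finset.mem_filter.1 hs).2, fun a ha haT' => ?_⟩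
      by_cases haT : a ∈ T
      · obtain ⟨b, hb⟩ := Finset.card_pos.1 (zero_lt_two.trans_le (hp a haT))
        obtain ⟨-, hab, hu⟩ := Finset.mem_filter.1 hb
        refine ⟨b, hab, fun hb' => ?_⟩
        obtain ⟨-, t, ht, htb⟩ := Finset.mem_filter.1 hb'
        exact haT' (hu t (hT' ht) htb ▸ ht)
      · obtain ⟨b, hb, hbS⟩ := h.2.2 a ha haT
        exact ⟨b, hb, fun hb' => hbS (Finset.mem_filter.1 hb').1⟩
    have hcard : T'.card + k - 1 ≤ (S.filter fun s => ∃ t ∈ T', G.Adj t s).card := by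
      calc T'.card + k - 1 ≤ T'.card * 2 := by omega
        _ ≤ ∑ t ∈ T', (priv t).card := Finset.card_nsmul_le_sum _ _ _ fun t ht => hp t (hT' ht)
        _ = (T'.biUnion priv).card := by
          refine (Finset.card_biUnion fun t ht t' ht' hne => ?_).symm
          refine Finset.disjoint_left.2 fun s hs hs' => hne ?_
          exact (Finset.mem_filter.1 hs').2.2 t (hT' ht) (Finset.mem_filter.1 hs).2.1
        _ ≤ _ := by
          refine Finset.card_le_card fun s hs => ?_
          obtain ⟨t, ht, hs⟩ := Finset.mem_biUnion.1 hs
          obtain ⟨hsS, hts, -⟩ := Finset.mem_filter.1 hs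
          exact Finset.mem_filter.2 ⟨hsS, t, ht, hts⟩
    obtain ⟨S'', hS'', hc''⟩ := Finset.exists_subset_card_eq hcard
    exact ⟨T', S'', hS'.mono hS'', by omega, hc''⟩
  · push Not at hp
    obtain ⟨t, ht, hpt⟩ := hp
    -- Otherwise drop a `t` with at most one private neighbour, and keep that neighbour `b`, or any
    -- neighbour if there is none, out of `S`. Then `b` dominates `t` and the gain does not
    -- decrease.
    obtain ⟨b, htb, hb⟩ : ∃ b, G.Adj t b ∧ priv t ⊆ {b} := by
      rcases (priv t).eq_empty_or_nonempty with he | ⟨b, hb⟩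
      · obtain ⟨b, hb⟩ := hA t (h.1 ht)
        exact ⟨b, hb, by simp [he]⟩
      · refine ⟨b, (Finset.mem_filter.1 hb).2.1, fun s hs => ?_⟩
        exact Finset.mem_singleton.2 (Finset.card_le_one.1 (by omega) s hs b hb)
    have hcT := Finset.card_erase_add_one ht
    have hcS : S.card - 1 ≤ (S.erase b).card := Finset.pred_card_le_card_erase
    refine ih (T.erase t).card (by omega) (T := T.erase t) (S := S.erase b) ⟨?_, ?_, ?_⟩
      (by omega) rfl
    · exact (Finset.erase_subset _ _).trans h.1
    · intro s hs
      obtain ⟨hsb, hsS⟩ := Finset.mem_erase.1 hs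
      by_contra! hno
      have hall : ∀ t' ∈ T, G.Adj t' s → t' = t := fun t' ht' ha => by
        by_contra hne
        exact hno t' (Finset.mem_erase.2 ⟨hne, ht'⟩) ha
      obtain ⟨t', ht', ha⟩ := h.2.1 s hsS
      have := hb (Finset.mem_filter.2 ⟨hsS, hall t' ht' ha ▸ ha, hall⟩)
      exact hsb (Finset.mem_singleton.1 this)
    · intro a ha haT
      by_cases hat : a = t
      · exact ⟨b, hat ▸ htb, by simp⟩
      · obtain ⟨c, hc, hcS⟩ := h.2.2 a ha fun haT' => haT (Finset.mem_erase.2 ⟨hat, haT'⟩)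
        exact ⟨c, hc, fun hc' => hcS (Finset.mem_of_mem_erase hc')⟩

/-- If no small exchange gains `k - 1`, the complement of `A` is nearly a minimum dominating
set. -/
theorem card_compl_le_of_forall_not_isExchange [Fintype V] [DecidableEq V] {k : ℕ} (hk : 2 ≤ k)
    {A : Finset V} (hA : ∀ a ∈ A, ∃ b, G.Adj a b) (hcover : ∀ x y, G.Adj x y → x ∈ A ∨ y ∈ A)
    (hopt : ∀ T S, G.IsExchange A T S → T.card < k → S.card ≠ T.card + k - 1) :
    Aᶜ.card ≤ G.dominationNumber + k - 2 := by
  by_contra! hlt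
  obtain ⟨X, hX, hcX⟩ := G.exists_isDominatingSet_card_eq
  -- The exchange that turns the complement of `A` into a minimum dominating set `X`; its gain is
  -- the difference of their sizes.
  have hex : G.IsExchange A (X ∩ A) (Aᶜ \ X) := by
    refine ⟨Finset.inter_subset_right, fun s hs => ?_, fun a ha haT => ?_⟩
    · simp only [Finset.mem_sdiff, Finset.mem_compl] at hs
      obtain ⟨u, hu, hsu⟩ := hX s hs.2
      exact ⟨u, Finset.mem_inter.2 ⟨hu, (hcover s u hsu).resolve_left hs.1⟩, hsu.symm⟩
    · obtain ⟨u, hu, hau⟩ := hX a fun h => haT (Finset.mem_inter.2 ⟨h, ha⟩)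
      exact ⟨u, hau, by simp [hu]⟩
  have h1 := Finset.card_inter_add_card_sdiff X A
  have h2 := Finset.card_sdiff_add_card_inter Aᶜ X
  have h3 : Aᶜ ∩ X = X \ A := by
    ext
    simp [and_comm]
  rw [h3] at h2
  obtain ⟨T, S, h, hT, hS⟩ := hex.exists_card_lt (k := k) (by omega) hA (by omega)
  exact hopt T S h hT hS

end Exchange

/-! ### Bipartite graphs attaining the bound, and their local characterization. -/

section Extremal

variable {V : Type*} {G : SimpleGraph V}

/-- There is a walk of length four from `v` to `w`. -/
def FourStep (G : SimpleGraph V) (v w : V) : Prop :=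
  ∃ a b c, G.Adj v a ∧ G.Adj a b ∧ G.Adj b c ∧ G.Adj c w

theorem Coloring.eq_of_adj_of_adj (C : G.Coloring (Fin 2)) {a b c : V} (h : G.Adj a b)
    (h' : G.Adj b c) : C a = C c := by
  have := C.valid h
  have := C.valid h'
  omega

theorem FourStep.color_eq {v w : V} (h : G.FourStep v w) (C : G.Coloring (Fin 2)) :
    C v = C w := by
  obtain ⟨a, b, c, h1, h2, h3, h4⟩ := h
  exact (C.eq_of_adj_of_adj h1 h2).trans (C.eq_of_adj_of_adj h3 h4)

variable {k : ℕ} {D : Finset V}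

/-- Otherwise exchange `k - 1` neighbours of `u` and of `v` for `u` and `v`. The two sets have
different colours, so any other vertex outside `D` loses neighbours from one of them only and keeps
at least one. The gain `2k - 4` exceeds `k - 2` as `k ≥ 3`. -/
theorem IsKDominatingSet.color_eq (hk : 3 ≤ k) (hD : G.IsKDominatingSet k D)
    (hc : D.card = G.dominationNumber + k - 2) (C : G.Coloring (Fin 2)) {u v : V}
    (hu : u ∉ D) (hv : v ∉ D) : C u = C v := by
  classical
  by_contra hne
  obtain ⟨S, hSD, hcS, -, hS⟩ := hD.exists_subset_card_eq hu u
  obtain ⟨S', hSD', hcS', -, hS'⟩ := hD.exists_subset_card_eq hv v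
  have hdisj : Disjoint S S' := Finset.disjoint_left.2 fun s hs hs' =>
    hne (C.eq_of_adj_of_adj (hS s hs) (hS' s hs').symm)
  have := dominationNumber_add_card_le (G := G) (T := {u, v}) (Finset.union_subset hSD hSD')
    (fun s hs => by
      rcases Finset.mem_union.1 hs with hs | hs
      · exact ⟨u, (hS s hs).symm, by simp⟩
      · exact ⟨v, (hS' s hs).symm, by simp⟩)
    (fun w hw _ => by
      by_cases hwu : C w = C u
      · obtain ⟨x, hx, hwx, hxS⟩ := hD.exists_adj_notMem hw (S := S) (by omega)
        refine ⟨x, hx, hwx, ?_⟩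
        rw [Finset.mem_union, not_or]
        exact ⟨hxS, fun h => hne (hwu.symm.trans (C.eq_of_adj_of_adj hwx (hS' x h).symm))⟩
      · obtain ⟨x, hx, hwx, hxS⟩ := hD.exists_adj_notMem hw (S := S') (by omega)
        refine ⟨x, hx, hwx, ?_⟩
        rw [Finset.mem_union, not_or]
        exact ⟨fun h => hwu (C.eq_of_adj_of_adj hwx (hS x h).symm), hxS⟩)
  rw [Finset.card_union_of_disjoint hdisj] at this
  have := Finset.card_le_two (a := u) (b := v)
  omega

/-- In the extremal case the vertices outside `D` are the non-isolated vertices of one colour. -/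
theorem IsKDominatingSet.notMem_of_adj (hk : 3 ≤ k) (hD : G.IsKDominatingSet k D)
    (hc : D.card = G.dominationNumber + k - 2) (C : G.Coloring (Fin 2)) {v a b : V}
    (hv : v ∉ D) (hav : C a = C v) (hab : G.Adj a b) : a ∉ D := by
  classical
  intro ha
  have hb : b ∈ D := by
    by_contra hb
    exact C.valid hab (hav.trans (hD.color_eq hk hc C hv hb))
  obtain ⟨S, hSD, hcS, hbS, hS⟩ := hD.exists_subset_card_eq hv b
  have haS : a ∉ S := fun h => C.valid (hS a h) hav.symm
  -- If `a` were in `D`, it could be removed along with `S`: its neighbour `b` stays, and no vertex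
  -- outside `D` relies on `a`, having the same colour. The gain would be `k - 1`.
  have := dominationNumber_add_card_le (G := G) (T := {v}) (S := insert a S)
    (Finset.insert_subset ha hSD)
    (fun s hs => by
      rcases Finset.mem_insert.1 hs with rfl | hs
      · exact ⟨b, hab, .inr ⟨hb, by simp [hab.ne', hbS]⟩⟩
      · exact ⟨v, (hS s hs).symm, by simp⟩)
    (fun w hw _ => by
      obtain ⟨x, hx, hwx, hxS⟩ := hD.exists_adj_notMem hw (S := S) (by omega)
      refine ⟨x, hx, hwx, ?_⟩
      rw [Finset.mem_insert, not_or]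
      refine ⟨?_, hxS⟩
      rintro rfl
      exact C.valid hwx ((hD.color_eq hk hc C hw hv).trans hav.symm))
  rw [Finset.card_insert_of_notMem haS, Finset.card_singleton] at this
  omega

/-- The same double exchange. A common neighbour of `u` and `v` would give a walk `u b u b v`; a
vertex `w` that loses all its neighbours in `D` has some `y` in `S` and `x` in `S'`, giving `u y w x
v`. -/
theorem IsKDominatingSet.fourStep (hk : 3 ≤ k) (hD : G.IsKDominatingSet k D)
    (hc : D.card = G.dominationNumber + k - 2) {u v : V} (hu : u ∉ D) (hv : v ∉ D) :
    G.FourStep u v := by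
  classical
  by_contra hno
  have hshare : ∀ b, G.Adj u b → ¬G.Adj v b := fun b hub hvb =>
    hno ⟨b, u, b, hub, hub.symm, hub, hvb.symm⟩
  obtain ⟨S, hSD, hcS, -, hS⟩ := hD.exists_subset_card_eq hu u
  obtain ⟨S', hSD', hcS', -, hS'⟩ := hD.exists_subset_card_eq hv v
  have hdisj : Disjoint S S' := Finset.disjoint_left.2 fun s hs hs' =>
    hshare s (hS s hs) (hS' s hs')
  have := dominationNumber_add_card_le (G := G) (T := {u, v}) (Finset.union_subset hSD hSD')
    (fun s hs => by
      rcases Finset.mem_union.1 hs with hs | hs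
      · exact ⟨u, (hS s hs).symm, by simp⟩
      · exact ⟨v, (hS' s hs).symm, by simp⟩)
    (fun w hw _ => by
      obtain ⟨x, hx, hwx, hxS⟩ := hD.exists_adj_notMem hw (S := S) (by omega)
      obtain ⟨y, hy, hwy, hyS⟩ := hD.exists_adj_notMem hw (S := S') (by omega)
      by_cases hxS' : x ∈ S'
      · by_cases hyS' : y ∈ S
        · exact absurd ⟨y, w, x, hS y hyS', hwy.symm, hwx, (hS' x hxS').symm⟩ hno
        · exact ⟨y, hy, hwy, by simp [hyS, hyS']⟩
      · exact ⟨x, hx, hwx, by simp [hxS, hxS']⟩)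
  rw [Finset.card_union_of_disjoint hdisj] at this
  have := Finset.card_le_two (a := u) (b := v)
  omega

variable (G) in
/-- The local condition on the set `A` of vertices reached from some vertex by walks of length four
which characterizes the bipartite graphs with `γₖ = γ + k - 2`. -/
def IsLocallyOptimal (k : ℕ) : Prop :=
  ∃ v, (∃ w, G.Adj v w) ∧ (∀ x y, G.Adj x y → G.FourStep v x ∨ G.FourStep v y) ∧
    (∀ a, G.FourStep v a → ∃ f : Fin k → V, (∀ i j, f i = f j → i = j) ∧ ∀ i, G.Adj a (f i)) ∧
    ∀ t : Fin k, ¬∃ (T : Fin t → V) (S : Fin (t + k - 1) → V), (∀ i j, S i = S j → i = j) ∧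
      (∀ i, G.FourStep v (T i)) ∧ (∀ j, ∃ i, G.Adj (T i) (S j)) ∧
      ∀ a, G.FourStep v a → (∃ i, a = T i) ∨ ∃ b, G.Adj a b ∧ ∀ j, b ≠ S j

theorem isLocallyOptimal_of_eq [Fintype V] [DecidableRel G.Adj] (hk : 3 ≤ k)
    (hG : G.IsBipartite) (hd : k ≤ G.maxDegree)
    (h : G.kDominationNumber k = G.dominationNumber + k - 2) : G.IsLocallyOptimal k := by
  classical
  obtain ⟨C⟩ := hG
  obtain ⟨D, hD, hc⟩ := G.exists_isKDominatingSet_card_eq k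
  have hlt := G.kDominationNumber_lt_card (by omega) hd
  obtain ⟨v, -, hv⟩ := Finset.exists_mem_notMem_of_card_lt_card
    (s := D) (t := Finset.univ) (by rwa [hc, Finset.card_univ])
  rw [h] at hc
  have nbr : ∀ w ∉ D, ∃ u, G.Adj w u := fun w hw => by
    obtain ⟨u, -, hu, -⟩ := hD.exists_adj_notMem hw (S := ∅) (by simp; omega)
    exact ⟨u, hu⟩
  -- This recovers `D` from the single vertex `v`: the end of a walk of length four is a
  -- non-isolated vertex of the colour of `v`.
  have hW : ∀ a, G.FourStep v a ↔ a ∉ D := by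
    refine fun a => ⟨fun hva => ?_, fun ha => hD.fourStep hk hc hv ha⟩
    have hC := hva.color_eq C
    obtain ⟨_, _, c, -, -, -, hca⟩ := hva
    exact hD.notMem_of_adj hk hc C hv hC.symm hca.symm
  refine ⟨v, nbr v hv, ?_⟩
  simp only [hW]
  refine ⟨?_, ?_, ?_⟩
  · intro x y hxy
    by_cases hx : C x = C v
    · exact .inl (hD.notMem_of_adj hk hc C hv hx hxy)
    · refine .inr (hD.notMem_of_adj hk hc C hv ?_ hxy.symm)
      have := C.valid hxy
      omega
  · intro a ha
    obtain ⟨S, hS, hcS⟩ := Finset.exists_subset_card_eq (hD.le_card_filter ha)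
    refine ⟨fun i => (S.equivFinOfCardEq hcS).symm i, fun i j hij => ?_, fun i => ?_⟩
    · simpa [Subtype.ext_iff] using hij
    · exact (Finset.mem_filter.1 (hS ((S.equivFinOfCardEq hcS).symm i).2)).2
  · rintro t ⟨T, S, hinj, hT, hS, hA⟩
    have := dominationNumber_add_card_le (G := G) (D := D) (T := Finset.univ.image T)
      (S := Finset.univ.image S)
      (fun s hs => by
        obtain ⟨j, -, rfl⟩ := Finset.mem_image.1 hs
        obtain ⟨i, hi⟩ := hS j
        by_contra hj
        exact C.valid hi (hD.color_eq hk hc C (hT i) hj))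
      (fun s hs => by
        obtain ⟨j, -, rfl⟩ := Finset.mem_image.1 hs
        obtain ⟨i, hi⟩ := hS j
        exact ⟨T i, hi.symm, by simp⟩)
      (fun a ha haT => by
        rcases hA a ha with ⟨i, rfl⟩ | ⟨b, hab, hb⟩
        · simp at haT
        · refine ⟨b, ?_, hab, ?_⟩
          · by_contra hbD
            exact C.valid hab (hD.color_eq hk hc C ha hbD)
          · simpa [eq_comm] using hb)
    rw [Finset.card_image_of_injective _ hinj, Finset.card_fin] at this
    -- Repetitions in the tuple `T` are harmless: they only increase the gain.
    have : (Finset.univ.image T).card ≤ t := by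
      simpa using Finset.card_image_le (s := Finset.univ) (f := T)
    omega

/-- The set `A` lies in one colour class and its vertices have degree at least `k`, so its
complement is `k`-dominating. The absence of small exchanges bounds its size by `γ + k - 2`; the
reverse inequality is that of Fink and Jacobson. -/
theorem eq_of_isLocallyOptimal [Fintype V] [DecidableRel G.Adj] (hk : 3 ≤ k)
    (hG : G.IsBipartite) (hd : k ≤ G.maxDegree) (h : G.IsLocallyOptimal k) :
    G.kDominationNumber k = G.dominationNumber + k - 2 := by
  classical
  obtain ⟨C⟩ := hG
  apply le_antisymm
  · obtain ⟨v, -, hcover, hdeg, hopt⟩ := h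
    have hmem : ∀ a, a ∈ Finset.univ.filter (G.FourStep v) ↔ G.FourStep v a := by simp
    have hK : G.IsKDominatingSet k (Finset.univ.filter (G.FourStep v))ᶜ := by
      intro a ha
      have ha : G.FourStep v a := by simpa using ha
      obtain ⟨f, hf, haf⟩ := hdeg a ha
      calc k = (Finset.univ.image f).card := by
            rw [Finset.card_image_of_injective _ hf, Finset.card_fin]
        _ = ((Finset.univ.image f : Finset V) : Set V).ncard := (Set.ncard_coe_finset _).symm
        _ ≤ _ := by
          refine Set.ncard_le_ncard fun u hu => ?_
          obtain ⟨i, rfl⟩ : ∃ i, f i = u := by simpa using hu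
          refine ⟨?_, haf i⟩
          rw [Finset.mem_compl, hmem]
          exact fun hw => C.valid (haf i) ((ha.color_eq C).symm.trans (hw.color_eq C))
    refine (G.kDominationNumber_le_card hK).trans
      (card_compl_le_of_forall_not_isExchange (by omega) ?_ ?_ ?_)
    · intro a ha
      obtain ⟨f, -, haf⟩ := hdeg a ((hmem a).1 ha)
      exact ⟨_, haf ⟨0, by omega⟩⟩
    · simpa only [hmem] using hcover
    · rintro T S ⟨hTA, hS, hA⟩ hT hcS
      let eT := (T.equivFinOfCardEq rfl).symm
      let eS := (S.equivFinOfCardEq hcS).symm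
      refine hopt ⟨T.card, hT⟩ ⟨fun i => eT i, fun j => eS j, ?_, ?_, ?_, ?_⟩
      · intro i j hij
        exact eS.injective (Subtype.ext hij)
      · exact fun i => (hmem _).1 (hTA (eT i).2)
      · intro j
        obtain ⟨t, ht, hts⟩ := hS (eS j) (eS j).2
        refine ⟨eT.symm ⟨t, ht⟩, ?_⟩
        simpa using hts
      · intro a ha
        by_cases haT : a ∈ T
        · exact .inl ⟨eT.symm ⟨a, haT⟩, by simp⟩
        · obtain ⟨b, hab, hb⟩ := hA a ((hmem a).2 ha) haT
          exact .inr ⟨b, hab, fun j hj => hb (hj ▸ (eS j).2)⟩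
  · obtain ⟨D, hD, hc⟩ := G.exists_isKDominatingSet_card_eq k
    have hlt := G.kDominationNumber_lt_card (by omega) hd
    obtain ⟨v, -, hv⟩ := Finset.exists_mem_notMem_of_card_lt_card
      (s := D) (t := Finset.univ) (by rwa [hc, Finset.card_univ])
    rw [← hc]
    exact hD.dominationNumber_add_le (by omega) hv

end Extremal

end SimpleGraph

/-! ### First-order definability of the local condition. -/

namespace SimpleGraph

open FirstOrder Language

/-- The property `P` of the valuations `v : α → Fin n` in finite graphs is expressed by a
first-order formula. -/
def FirstOrderDefinable {α : Type} (P : ∀ n, SimpleGraph (Fin n) → (α → Fin n) → Prop) : Prop :=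
  ∃ φ : Language.graph.Formula α, ∀ (n : ℕ) (G : SimpleGraph (Fin n)) (v : α → Fin n),
    @Formula.Realize _ (Fin n) G.structure _ φ v ↔ P n G v

namespace FirstOrderDefinable

variable {α : Type} {P Q : ∀ n, SimpleGraph (Fin n) → (α → Fin n) → Prop}

theorem adj (x y : α) : FirstOrderDefinable fun _ G v => G.Adj (v x) (v y) :=
  ⟨Language.adj.formula₂ (.var x) (.var y), fun n G v => by
    let := G.structure
    rw [Formula.realize_rel₂]
    rfl⟩

theorem eq (x y : α) : FirstOrderDefinable fun _ _ v => v x = v y :=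
  ⟨Term.equal (.var x) (.var y), fun n G v => by
    let := G.structure
    rw [Formula.realize_equal]
    rfl⟩

theorem const (α : Type) (p : Prop) : FirstOrderDefinable (α := α) fun _ _ _ => p := by
  by_cases hp : p
  · exact ⟨⊤, fun n G v => by simp [hp]⟩
  · exact ⟨⊥, fun n G v => by simp [hp]⟩

theorem not (hP : FirstOrderDefinable P) : FirstOrderDefinable fun n G v => ¬P n G v := by
  obtain ⟨φ, hφ⟩ := hP
  exact ⟨φ.not, fun n G v => by simp [hφ]⟩

theorem imp (hP : FirstOrderDefinable P) (hQ : FirstOrderDefinable Q) :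
    FirstOrderDefinable fun n G v => P n G v → Q n G v := by
  obtain ⟨φ, hφ⟩ := hP
  obtain ⟨ψ, hψ⟩ := hQ
  exact ⟨φ.imp ψ, fun n G v => by simp [hφ, hψ]⟩

theorem and (hP : FirstOrderDefinable P) (hQ : FirstOrderDefinable Q) :
    FirstOrderDefinable fun n G v => P n G v ∧ Q n G v := by
  obtain ⟨φ, hφ⟩ := hP
  obtain ⟨ψ, hψ⟩ := hQ
  exact ⟨φ ⊓ ψ, fun n G v => by simp [hφ, hψ]⟩

theorem or (hP : FirstOrderDefinable P) (hQ : FirstOrderDefinable Q) :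
    FirstOrderDefinable fun n G v => P n G v ∨ Q n G v := by
  obtain ⟨φ, hφ⟩ := hP
  obtain ⟨ψ, hψ⟩ := hQ
  exact ⟨φ ⊔ ψ, fun n G v => by simp [hφ, hψ]⟩

/-- Index types do not depend on the graph, so this is a finite conjunction rather than a
quantifier. -/
theorem forall_index {β : Type} [Finite β]
    {R : ∀ n, SimpleGraph (Fin n) → (α → Fin n) → β → Prop}
    (hR : ∀ b, FirstOrderDefinable fun n G v => R n G v b) :
    FirstOrderDefinable fun n G v => ∀ b, R n G v b := by
  choose φ hφ using hR
  exact ⟨Formula.iInf φ, fun n G v => by simp [hφ]⟩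

theorem exists_index {β : Type} [Finite β]
    {R : ∀ n, SimpleGraph (Fin n) → (α → Fin n) → β → Prop}
    (hR : ∀ b, FirstOrderDefinable fun n G v => R n G v b) :
    FirstOrderDefinable fun n G v => ∃ b, R n G v b := by
  choose φ hφ using hR
  exact ⟨Formula.iSup φ, fun n G v => by simp [hφ]⟩

theorem exists_tuple {β : Type} [Finite β]
    {R : ∀ n, SimpleGraph (Fin n) → (α → Fin n) → (β → Fin n) → Prop}
    (hR : FirstOrderDefinable fun n G (v : α ⊕ β → Fin n) =>
      R n G (fun a => v (.inl a)) fun b => v (.inr b)) :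
    FirstOrderDefinable fun n G v => ∃ f, R n G v f := by
  obtain ⟨φ, hφ⟩ := hR
  exact ⟨φ.iExs β, fun n G v => by simp [hφ]⟩

theorem exists_vertex {R : ∀ n, SimpleGraph (Fin n) → (α → Fin n) → Fin n → Prop}
    (hR : FirstOrderDefinable fun n G (v : α ⊕ Unit → Fin n) =>
      R n G (fun a => v (.inl a)) (v (.inr ()))) :
    FirstOrderDefinable fun n G v => ∃ x, R n G v x := by
  obtain ⟨φ, hφ⟩ := exists_tuple (β := Unit) (R := fun n G v f => R n G v (f ())) hR
  refine ⟨φ, fun n G v => (hφ n G v).trans ⟨fun ⟨f, hf⟩ => ⟨f (), hf⟩, fun ⟨x, hx⟩ => ?_⟩⟩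
  exact ⟨fun _ => x, hx⟩

theorem forall_vertex {R : ∀ n, SimpleGraph (Fin n) → (α → Fin n) → Fin n → Prop}
    (hR : FirstOrderDefinable fun n G (v : α ⊕ Unit → Fin n) =>
      R n G (fun a => v (.inl a)) (v (.inr ()))) :
    FirstOrderDefinable fun n G v => ∀ x, R n G v x := by
  obtain ⟨φ, hφ⟩ := (exists_vertex (R := fun n G v x => ¬R n G v x) hR.not).not
  exact ⟨φ, fun n G v => (hφ n G v).trans (by push Not; rfl)⟩

open Sum (inl inr)

theorem fourStep (x y : α) : FirstOrderDefinable fun _ G v => G.FourStep (v x) (v y) :=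
  exists_vertex <| exists_vertex <| exists_vertex <|
    .and (adj (inl (inl (inl x))) (inl (inl (inr ())))) <|
    .and (adj (inl (inl (inr ()))) (inl (inr ()))) <|
    .and (adj (inl (inr ())) (inr ())) <| adj (inr ()) (inl (inl (inl y)))

/-- In the nested sums `inr` is the most recently bound vertex or tuple, and each `inl` passes over
one binder. -/
theorem isLocallyOptimal (α : Type) (k : ℕ) :
    FirstOrderDefinable (α := α) fun _ G _ => G.IsLocallyOptimal k := by
  refine exists_vertex (.and ?_ (.and ?_ (.and ?_ ?_)))
  · exact exists_vertex (adj (inl (inr ())) (inr ()))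
  · exact forall_vertex <| forall_vertex <| .imp (adj (inl (inr ())) (inr ())) <|
      .or (fourStep (inl (inl (inr ()))) (inl (inr ())))
        (fourStep (inl (inl (inr ()))) (inr ()))
  · refine forall_vertex <| .imp (fourStep (inl (inr ())) (inr ())) <| exists_tuple <|
      .and ?_ ?_
    · exact forall_index fun i => forall_index fun j => .imp (eq (inr i) (inr j)) (const _ _)
    · exact forall_index fun i => adj (inl (inr ())) (inr i)
  · refine forall_index fun t => .not <| exists_tuple <| exists_tuple <|
      .and ?_ <| .and ?_ <| .and ?_ ?_
    · exact forall_index fun i => forall_index fun j => .imp (eq (inr i) (inr j)) (const _ _)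
    · exact forall_index fun i => fourStep (inl (inl (inr ()))) (inl (inr i))
    · exact forall_index fun j => exists_index fun i => adj (inl (inr i)) (inr j)
    · refine forall_vertex <| .imp (fourStep (inl (inl (inl (inr ())))) (inr ())) <| .or ?_ ?_
      · exact exists_index fun i => eq (inr ()) (inl (inl (inr i)))
      · exact exists_vertex <| .and (adj (inl (inr ())) (inr ())) <|
          forall_index fun j => .not (eq (inr ()) (inl (inl (inr j))))

end FirstOrderDefinable

end SimpleGraph

theorem mainTheorem9 (k : ℕ) (hk : 3 ≤ k) :
    ∃ (c : Ram.Prog) (p : Polynomial ℕ),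
      ∀ (n : ℕ) (G : SimpleGraph (Fin n)) [DecidableRel G.Adj],
        G.IsBipartite → k ≤ G.maxDegree →
          Ram.DecidesWithin c G.encode (p.eval G.encode.length)
            (G.kDominationNumber k = G.dominationNumber + k - 2) := by
  obtain ⟨φ, hφ⟩ := SimpleGraph.FirstOrderDefinable.isLocallyOptimal Empty k
  obtain ⟨c, p, hc⟩ := Ram.decidesWithin_sentence φ
  refine ⟨c, p, fun n G _ hG hd => ?_⟩
  have h := (hφ n G default).trans
    ⟨SimpleGraph.eq_of_isLocallyOptimal hk hG hd, SimpleGraph.isLocallyOptimal_of_eq hk hG hd⟩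
  exact propext h ▸ hc n G
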